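/- Let $K$ be a field, let $0<n_1<n_2<n_3<n_4$ be integers with $\gcd(n_1,\dots,n_4)=1$, and let $C$ be the monomial curve $x_i=t^{n_i}$ in $\mathbb A^4(K)$. Its toric ideal $I(C)$ is the kernel of $K[x_1,\dots,x_4]\to K[t]$, $x_i\mapsto t^{n_i}$. For $f\ne 0$ let $f_*$ be the homogeneous summand of $f$ of least degree, and let $I(C)_*$ be the ideal generated by all $f_*$ with $0\neq f\in I(C)$. Assume that the tangent cone of $C$ at the origin is Cohen–Macaulay, that is, $K[x_1,\dots,x_4]/I(C)_*$ is a Cohen–Macaulay ring. Assume moreover that (case 2(a)) there are integers $a_i$, $a_{ij}$ with $0<a_{ij}<a_j$ such that $I(C)$ is minimally generated by $$f_1=x_1^{a_1}-x_2^{a_{12}}x_3^{a_{13}},\quad f_2=x_2^{a_2}-x_3^{a_{23}}x_4^{a_{24}},\quad f_3=x_3^{a_3}-x_1^{a_{31}}x_4^{a_{34}},$$ $$f_4=x_4^{a_4}-x_1^{a_{41}}x_2^{a_{42}},\quad f_5=x_1^{a_{41}}x_3^{a_{23}}-x_2^{a_{12}}x_4^{a_{34}},$$ and that $a_{34}\le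 a_{24}$. ("Minimally generated" means generated by the listed pairwise distinct elements and by no proper subset of them.) Put $$f_6=x_2^{a_2+a_{12}}-x_1^{a_{41}}x_3^{2a_{23}}x_4^{a_{24}-a_{34}},\qquad e=a_{41}+2a_{23}+a_{24}-a_{34}\qquad\text{if } a_{23}<a_{13},$$ $$f_6=x_2^{a_2+a_{12}}-x_1^{a_1}x_3^{a_{23}-a_{13}}x_4^{a_{24}},\qquad e=a_1+a_{24}+a_{23}-a_{13}\qquad\text{if } a_{13}\le a_{23}.$$ Then, in each of the two subcases $a_{23}<a_{13}$ and $a_{13}\le a_{23}$: 1. $\{f_1,\dots,f_6\}$ is a standard basis of $I(C)$ with respect to the negative degree reverse lexicographic order with $x_4>x_3>x_2>x_1$; that is, it is contained in $I(C)$, and the leading monomials of its elements generate the ideal generated by the leading monomials of all nonzero elements of $I(C)$. 2. If $a_3\le a_{31}+a_{34}$, $a_2+a_{12}\le e$ and $a_{12}+a_{34}\le a_{41}+a_{23}$, then in each of the eight cases, according to whether each of these three relations is an equality or a strict inequality, $I(C)_*$ is minimally generated by the six elements $$x_2^{a_{12}}x_3^{a_{13}},\quad x_3^{a_{23}}x_4^{a_{24}},\quad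 g_3,\quad x_4^{a_4},\quad g_5,\quad g_6,$$ where $g_3=x_3^{a_3}$ if $a_3<a_{31}+a_{34}$ and $g_3=f_3$ if $a_3=a_{31}+a_{34}$; $g_5=x_2^{a_{12}}x_4^{a_{34}}$ if $a_{12}+a_{34}<a_{41}+a_{23}$ and $g_5=f_5$ if $a_{12}+a_{34}=a_{41}+a_{23}$; $g_6=x_2^{a_2+a_{12}}$ if $a_2+a_{12}<e$ and $g_6=f_6$ if $a_2+a_{12}=e$. -/

import Mathlib

open MvPolynomial

noncomputable section

/-! The variables `x₁, x₂, x₃, x₄` are `X 0, X 1, X 2, X 3`. -/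

/-- The toric ideal `I(C)` of the monomial curve `x_i = t ^ n_i`: the kernel of the `K`-algebra
homomorphism `K[x₁, …, x₄] → K[t]` sending `x_i` to `t ^ n_i`. -/
def toricIdeal (K : Type*) [Field K] (n : Fin 4 → ℕ) : Ideal (MvPolynomial (Fin 4) K) :=
  RingHom.ker (aeval (fun i => (Polynomial.X : Polynomial K) ^ n i) :
    MvPolynomial (Fin 4) K →ₐ[K] Polynomial K)

/-- The homogeneous summand of `f` of least degree (and `0` for `f = 0`). -/
def lowestForm {K : Type*} [Field K] (f : MvPolynomial (Fin 4) K) : MvPolynomial (Fin 4) K :=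
  homogeneousComponent (sInf {d : ℕ | homogeneousComponent d f ≠ 0}) f

/-- The ideal `I_*` generated by the least homogeneous summands of all elements of `I`. -/
def lowestFormIdeal {K : Type*} [Field K] (I : Ideal (MvPolynomial (Fin 4) K)) :
    Ideal (MvPolynomial (Fin 4) K) :=
  Ideal.span (lowestForm '' (I : Set (MvPolynomial (Fin 4) K)))

/-- The family `g` is an irredundant generating family of the ideal `J`: the members of `g` are
pairwise distinct, they generate `J`, and no proper subset of them generates `J`. -/
def IsMinimallyGeneratedBy {R : Type*} [CommRing R] {ι : Type*} (J : Ideal R) (g : ι → R) :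
    Prop :=
  Ideal.span (Set.range g) = J ∧ ∀ i, g i ∉ Ideal.span (g '' {i}ᶜ)

/-- `x ^ α > x ^ β` in the negative degree reverse lexicographic order with
`x₄ > x₃ > x₂ > x₁`: either `x ^ α` has the smaller total degree, or the degrees agree and, at the
least variable at which the exponents differ, `α` has the smaller exponent. -/
def NegDegRevLexGT (α β : Fin 4 →₀ ℕ) : Prop :=
  α.degree < β.degree ∨
    (α.degree = β.degree ∧ ∃ i, (∀ j < i, α j = β j) ∧ α i < β i)

/-- `x ^ α` is the leading monomial of the (nonzero) polynomial `f`. -/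
def IsLeadingExponent {K : Type*} [Field K] (f : MvPolynomial (Fin 4) K) (α : Fin 4 →₀ ℕ) : Prop :=
  α ∈ f.support ∧ ∀ β ∈ f.support, β ≠ α → NegDegRevLexGT α β

/-- The ideal generated by the leading monomials of the nonzero elements of `S`. -/
def leadingIdeal {K : Type*} [Field K] (S : Set (MvPolynomial (Fin 4) K)) :
    Ideal (MvPolynomial (Fin 4) K) :=
  Ideal.span {m | ∃ f ∈ S, ∃ α, IsLeadingExponent f α ∧ m = monomial α 1}

/-- `G` is a standard basis of `I` for the negative degree reverse lexicographic order with
`x₄ > x₃ > x₂ > x₁`. -/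
def IsStandardBasis {K : Type*} [Field K] (I : Ideal (MvPolynomial (Fin 4) K))
    (G : Set (MvPolynomial (Fin 4) K)) : Prop :=
  G.Finite ∧ G ⊆ I ∧ leadingIdeal G = leadingIdeal (I : Set (MvPolynomial (Fin 4) K))

/-- A local ring is Cohen–Macaulay if it is Noetherian and its maximal ideal contains a regular
sequence whose length is the Krull dimension (that is, depth = dimension). -/
def IsCohenMacaulayLocalRing (R : Type*) [CommRing R] [IsLocalRing R] : Prop :=
  IsNoetherianRing R ∧ ∃ rs : List R, (∀ r ∈ rs, r ∈ IsLocalRing.maximalIdeal R) ∧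
    RingTheory.Sequence.IsRegular R rs ∧ ((rs.length : ℕ) : WithBot ℕ∞) = ringKrullDim R

/-- A Cohen–Macaulay ring: Noetherian, with all localizations at primes Cohen–Macaulay. -/
def IsCohenMacaulayRing (R : Type*) [CommRing R] : Prop :=
  IsNoetherianRing R ∧ ∀ (p : Ideal R) [p.IsPrime],
    IsCohenMacaulayLocalRing (Localization.AtPrime p)

/-- The monomial curve with exponents `n` has Cohen–Macaulay tangent cone at the origin; the
coordinate ring of the tangent cone is `K[x₁, …, x₄] / I(C)_*`. -/
def HasCohenMacaulayTangentCone (K : Type*) [Field K] (n : Fin 4 → ℕ) : Prop :=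
  IsCohenMacaulayRing (MvPolynomial (Fin 4) K ⧸ lowestFormIdeal (toricIdeal K n))

/-- The exponents `a_i` and `a_ij` occurring in the generators of case 2(a). -/
structure ExponentData where
  (a1 a2 a3 a4 a12 a13 a23 a24 a31 a34 a41 a42 : ℕ)

namespace ExponentData

variable (K : Type*) [Field K] (a : ExponentData)

/-- `f₁ = x₁^a₁ - x₂^a₁₂ x₃^a₁₃` -/
def f1 : MvPolynomial (Fin 4) K := X 0 ^ a.a1 - X 1 ^ a.a12 * X 2 ^ a.a13

/-- `f₂ = x₂^a₂ - x₃^a₂₃ x₄^a₂₄` -/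
def f2 : MvPolynomial (Fin 4) K := X 1 ^ a.a2 - X 2 ^ a.a23 * X 3 ^ a.a24

/-- `f₃ = x₃^a₃ - x₁^a₃₁ x₄^a₃₄` -/
def f3 : MvPolynomial (Fin 4) K := X 2 ^ a.a3 - X 0 ^ a.a31 * X 3 ^ a.a34

/-- `f₄ = x₄^a₄ - x₁^a₄₁ x₂^a₄₂` -/
def f4 : MvPolynomial (Fin 4) K := X 3 ^ a.a4 - X 0 ^ a.a41 * X 1 ^ a.a42

/-- `f₅ = x₁^a₄₁ x₃^a₂₃ - x₂^a₁₂ x₄^a₃₄` -/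
def f5 : MvPolynomial (Fin 4) K := X 0 ^ a.a41 * X 2 ^ a.a23 - X 1 ^ a.a12 * X 3 ^ a.a34

/-- `f₆ = x₂^(a₂ + a₁₂) - x₁^a₄₁ x₃^(2 a₂₃) x₄^(a₂₄ - a₃₄)`, used when `a₃₄ ≤ a₂₄` and
`a₂₃ < a₁₃`. -/
def f6 : MvPolynomial (Fin 4) K :=
  X 1 ^ (a.a2 + a.a12) - X 0 ^ a.a41 * X 2 ^ (2 * a.a23) * X 3 ^ (a.a24 - a.a34)

/-- `f₆ = x₂^(a₂ + a₁₂) - x₁^a₁ x₃^(a₂₃ - a₁₃) x₄^a₂₄`, used when `a₁₃ ≤ a₂₃`. -/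
def f6' : MvPolynomial (Fin 4) K :=
  X 1 ^ (a.a2 + a.a12) - X 0 ^ a.a1 * X 2 ^ (a.a23 - a.a13) * X 3 ^ a.a24

/-- `I(C)` is given as in case 2(a): `0 < a_ij < a_j` and `I(C)` is minimally generated by
`f₁, …, f₅`. -/
def IsCase2a (n : Fin 4 → ℕ) : Prop :=
  (0 < a.a12 ∧ a.a12 < a.a2) ∧ (0 < a.a13 ∧ a.a13 < a.a3) ∧
  (0 < a.a23 ∧ a.a23 < a.a3) ∧ (0 < a.a24 ∧ a.a24 < a.a4) ∧
  (0 < a.a31 ∧ a.a31 < a.a1) ∧ (0 < a.a34 ∧ a.a34 < a.a4) ∧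
  (0 < a.a41 ∧ a.a41 < a.a1) ∧ (0 < a.a42 ∧ a.a42 < a.a2) ∧
  IsMinimallyGeneratedBy (toricIdeal K n) ![a.f1 K, a.f2 K, a.f3 K, a.f4 K, a.f5 K]

end ExponentData

end

/-! Sort monomials into fibres, the finite sets of monomials with the same image `t ^ w`. An element
of `I(C)` has coefficient sum zero on every fibre, and an element of `I(C)_*` has coefficient sum
zero on the top-degree part of every fibre (`coeffSum_eq_zero_of_mem_lowestFormIdeal`).

Call a monomial standard if no leading monomial of `f₁, …, f₆` divides it. Replacing a leading term
by its tail stays in the fibre and goes down in the local order, so it ends at a standard monomial.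
If no fibre contains two standard monomials, the standard one is the smallest of its fibre and has
maximal degree there. The vanishing sums then give both claims without any S-polynomial
(`isStandardBasis_of_isStandard_unique`, `lowestFormIdeal_eq_of_isStandard_unique`).

Uniqueness (`IsCase2a.eq_of_isStandard`) is proved by cancelling the common power of `x₁` and
comparing normal forms modulo `x₁, f₁, …, f₅`, which depend on the weight only.

The intended terms lead only if three degree inequalities hold; these come from Cohen–Macaulayness,
which makes `x₁` a nonzerodivisor modulo `I(C)_*`. Were one to fail, some `x₁ ^ k * s` would lie in
`I(C)_*`, hence also `s`; but `s` is alone in its fibre, so it cannot (`IsCase2a.degree_le`). -/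

noncomputable section

/-! ### Coefficient sums over fibres of the weight -/

variable {K : Type*} [Field K]

/-- The weight of a monomial: the exponent of its image in `K[t]`. -/
def wt (n : Fin 4 → ℕ) (u : Fin 4 →₀ ℕ) : ℕ := ∑ i, u i * n i

lemma wt_add (n : Fin 4 → ℕ) (u v : Fin 4 →₀ ℕ) : wt n (u + v) = wt n u + wt n v := by
  simp [wt, add_mul, Finset.sum_add_distrib]

open Classical in
/-- The sum of the coefficients of `f` at the exponents in `S`. -/
def coeffSum (S : Set (Fin 4 →₀ ℕ)) : MvPolynomial (Fin 4) K →ₗ[K] K :=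
  (basisMonomials (Fin 4) K).constr K (fun u => if u ∈ S then 1 else 0)

open Classical in
lemma coeffSum_monomial (S : Set (Fin 4 →₀ ℕ)) (u : Fin 4 →₀ ℕ) (r : K) :
    coeffSum S (monomial u r) = if u ∈ S then r else 0 := by
  have h : monomial u r = r • basisMonomials (Fin 4) K u := by
    simp [smul_monomial]
  rw [h, map_smul, coeffSum, Module.Basis.constr_basis]
  split_ifs <;> simp

open Classical in
lemma coeffSum_eq_sum (S : Set (Fin 4 →₀ ℕ)) (f : MvPolynomial (Fin 4) K) :
    coeffSum S f = ∑ u ∈ f.support, if u ∈ S then coeff u f else 0 := by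
  conv_lhs => rw [f.as_sum]
  rw [map_sum]
  exact Finset.sum_congr rfl fun u _ => coeffSum_monomial S u _

lemma coeffSum_congr {S T : Set (Fin 4 →₀ ℕ)} {f : MvPolynomial (Fin 4) K}
    (h : ∀ u ∈ f.support, (u ∈ S ↔ u ∈ T)) : coeffSum S f = coeffSum T f := by
  classical
  rw [coeffSum_eq_sum, coeffSum_eq_sum]
  exact Finset.sum_congr rfl fun u hu => if_congr (h u hu) rfl rfl

lemma coeffSum_eq_zero {S : Set (Fin 4 →₀ ℕ)} {f : MvPolynomial (Fin 4) K}
    (h : ∀ u ∈ f.support, u ∉ S) : coeffSum S f = 0 := by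
  rw [coeffSum_eq_sum]
  exact Finset.sum_eq_zero fun u hu => by simp [h u hu]

lemma coeffSum_singleton (u : Fin 4 →₀ ℕ) (f : MvPolynomial (Fin 4) K) :
    coeffSum {u} f = coeff u f := by
  classical
  rw [coeffSum_eq_sum]
  simp [Finset.sum_ite_eq']
  tauto

lemma coeffSum_monomial_mul (S : Set (Fin 4 →₀ ℕ)) (m : Fin 4 →₀ ℕ)
    (f : MvPolynomial (Fin 4) K) :
    coeffSum S (monomial m 1 * f) = coeffSum {u | m + u ∈ S} f := by
  induction f using MvPolynomial.monomial_add_induction_on with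
  | C r => rw [C_apply, monomial_mul, one_mul, coeffSum_monomial, coeffSum_monomial]; rfl
  | monomial_add u r f _ _ ih =>
    rw [mul_add, map_add, map_add, ih]
    rw [monomial_mul, one_mul, coeffSum_monomial, coeffSum_monomial]; rfl

/-- A coefficient sum vanishing on all monomial multiples of a set of generators vanishes on the
ideal. -/
lemma coeffSum_eq_zero_of_mem_span {S : Set (Fin 4 →₀ ℕ)} {G : Set (MvPolynomial (Fin 4) K)}
    (h : ∀ g ∈ G, ∀ m, coeffSum S (monomial m 1 * g) = 0) {f : MvPolynomial (Fin 4) K}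
    (hf : f ∈ Ideal.span G) : coeffSum S f = 0 := by
  suffices H : ∀ q, coeffSum S (q * f) = 0 by simpa using H 1
  induction hf using Submodule.span_induction with
  | mem g hg =>
    intro q
    induction q using MvPolynomial.monomial_add_induction_on with
    | C r =>
      have := h g hg 0
      rw [C_mul', map_smul]
      simpa using Or.inr this
    | monomial_add u r q _ _ ih =>
      rw [add_mul, map_add, ih, add_zero]
      have : monomial u r = r • monomial u (1 : K) := by simp [smul_monomial]
      rw [this, smul_mul_assoc, map_smul, h g hg, smul_zero]
  | zero => simp
  | add x y _ _ hx hy => intro q; rw [mul_add, map_add, hx, hy, add_zero]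
  | smul a x _ hx => intro q; rw [smul_eq_mul, ← mul_assoc]; exact hx _

lemma aeval_monomial_eq (n : Fin 4 → ℕ) (u : Fin 4 →₀ ℕ) (r : K) :
    aeval (fun i => (Polynomial.X : Polynomial K) ^ n i) (monomial u r) =
      Polynomial.monomial (wt n u) r := by
  rw [aeval_monomial, Finsupp.prod_fintype _ _ (by simp)]
  simp_rw [← pow_mul]
  rw [Finset.prod_pow_eq_pow_sum, Polynomial.algebraMap_eq, Polynomial.C_mul_X_pow_eq_monomial]
  simp [wt, mul_comm]

lemma coeffSum_weight (n : Fin 4 → ℕ) (w : ℕ) (f : MvPolynomial (Fin 4) K) :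
    coeffSum {u | wt n u = w} f =
      (aeval (fun i => (Polynomial.X : Polynomial K) ^ n i) f).coeff w := by
  induction f using MvPolynomial.monomial_add_induction_on with
  | C r => rw [C_apply, aeval_monomial_eq, coeffSum_monomial, Polynomial.coeff_monomial]
           by_cases h : wt n 0 = w <;> simp [h]
  | monomial_add u r f _ _ ih =>
    rw [map_add, map_add, ih, aeval_monomial_eq, coeffSum_monomial, Polynomial.coeff_add,
      Polynomial.coeff_monomial]
    by_cases h : wt n u = w <;> simp [h]

lemma coeffSum_weight_eq_zero {n : Fin 4 → ℕ} (w : ℕ) {f : MvPolynomial (Fin 4) K}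
    (hf : f ∈ toricIdeal K n) : coeffSum {u | wt n u = w} f = 0 := by
  have h : aeval (fun i => (Polynomial.X : Polynomial K) ^ n i) f = 0 := hf
  rw [coeffSum_weight, h, Polynomial.coeff_zero]

lemma binomial_mem_toricIdeal {n : Fin 4 → ℕ} {u v : Fin 4 →₀ ℕ} :
    (monomial u 1 - monomial v 1 : MvPolynomial (Fin 4) K) ∈ toricIdeal K n ↔
      wt n u = wt n v := by
  rw [toricIdeal, RingHom.mem_ker, map_sub]
  erw [aeval_monomial_eq, aeval_monomial_eq]
  rw [sub_eq_zero]
  constructor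
  · intro h
    have := congrArg (fun p => Polynomial.coeff p (wt n u)) h
    simp only [Polynomial.coeff_monomial, if_true] at this
    by_contra hne
    rw [if_neg (Ne.symm hne)] at this
    exact one_ne_zero this
  · rintro h; rw [h]

/-- A function on the exponents that does not change under the moves given by binomial generators
of the toric ideal is determined by the weight. -/
lemma eq_of_wt_eq {n : Fin 4 → ℕ} {ι : Type*} {p q : ι → Fin 4 →₀ ℕ}
    (hI : toricIdeal K n = Ideal.span (Set.range fun i => monomial (p i) 1 - monomial (q i) 1))
    {α : Type*} (φ : (Fin 4 →₀ ℕ) → α) (hφ : ∀ i m, φ (m + p i) = φ (m + q i))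
    {u v : Fin 4 →₀ ℕ} (huv : wt n u = wt n v) : φ u = φ v := by
  have h := (binomial_mem_toricIdeal (K := K)).2 huv
  rw [hI] at h
  -- Summing coefficients over a level set of `φ` kills every monomial multiple of a generator,
  -- hence the whole ideal. On this binomial the sum would be `-1` if `φ u ≠ φ v`.
  have key : coeffSum {x | φ x = φ v} (monomial u 1 - monomial v 1 : MvPolynomial (Fin 4) K) = 0 := by
    refine coeffSum_eq_zero_of_mem_span ?_ h
    rintro _ ⟨i, rfl⟩ m
    rw [mul_sub, monomial_mul, monomial_mul, map_sub, one_mul, coeffSum_monomial,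
      coeffSum_monomial, sub_eq_zero]
    classical
    exact if_congr (by rw [Set.mem_ofPred_eq, hφ]; rfl) rfl rfl
  by_contra hne
  simp [coeffSum_monomial, hne] at key

/-- A monomial divisible by no term of the binomial generators is alone in its fibre. -/
lemma eq_of_wt_eq_of_not_le {n : Fin 4 → ℕ} {ι : Type*} {p q : ι → Fin 4 →₀ ℕ}
    (hI : toricIdeal K n = Ideal.span (Set.range fun i => monomial (p i) 1 - monomial (q i) 1))
    {s v : Fin 4 →₀ ℕ} (hs : ∀ i, ¬ p i ≤ s ∧ ¬ q i ≤ s) (h : wt n s = wt n v) : v = s := by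
  have := eq_of_wt_eq hI (fun x => x = s) (fun i m => ?_) h
  · simpa using this
  · have h1 : m + p i ≠ s := fun e => (hs i).1 (e ▸ le_add_self)
    have h2 : m + q i ≠ s := fun e => (hs i).2 (e ▸ le_add_self)
    simp [h1, h2]

/-! ### Least homogeneous summands -/

lemma sInf_le_degree {f : MvPolynomial (Fin 4) K} {u : Fin 4 →₀ ℕ} (hu : u ∈ f.support) :
    sInf {d : ℕ | homogeneousComponent d f ≠ 0} ≤ u.degree := by
  refine Nat.sInf_le fun h => ?_
  have := congrArg (coeff u) h
  rw [coeff_homogeneousComponent, if_pos rfl, coeff_zero] at this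
  exact mem_support_iff.1 hu this

lemma coeffSum_homogeneousComponent (S : Set (Fin 4 →₀ ℕ)) (d : ℕ)
    (f : MvPolynomial (Fin 4) K) :
    coeffSum S (homogeneousComponent d f) = coeffSum {u | u ∈ S ∧ u.degree = d} f := by
  classical
  rw [coeffSum_eq_sum, coeffSum_eq_sum]
  refine Finset.sum_subset_zero_on_sdiff (fun u hu => ?_) (fun u hu => ?_) (fun u hu => ?_)
  · rw [mem_support_iff, coeff_homogeneousComponent] at hu
    rw [mem_support_iff]
    intro h
    simp [h] at hu
  · simp only [Finset.mem_sdiff, mem_support_iff, coeff_homogeneousComponent] at hu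
    simp only [Set.mem_ofPred_eq]
    split_ifs with h
    · have := hu.2
      simp only [h.2, if_true, not_not] at this
      exact this
    · rfl
  · simp only [mem_support_iff, coeff_homogeneousComponent] at hu ⊢
    have : u.degree = d := by by_contra h; simp [h] at hu
    simp [this]

/-- The sum of the coefficients at the monomials of maximal degree in a fibre vanishes on the ideal
of least homogeneous summands. -/
lemma coeffSum_eq_zero_of_mem_lowestFormIdeal {n : Fin 4 → ℕ} {w D : ℕ}
    (hD : ∀ u, wt n u = w → u.degree ≤ D) {f : MvPolynomial (Fin 4) K}
    (hf : f ∈ lowestFormIdeal (toricIdeal K n)) :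
    coeffSum {u | wt n u = w ∧ u.degree = D} f = 0 := by
  refine coeffSum_eq_zero_of_mem_span ?_ hf
  rintro _ ⟨g, hg, rfl⟩ m
  rw [coeffSum_monomial_mul, lowestForm, coeffSum_homogeneousComponent]
  set d := sInf {d : ℕ | homogeneousComponent d g ≠ 0}
  -- In this case the degree condition is automatic on the support of `g`: degrees there are at
  -- least `d`, and `hD` bounds them by `d` within the fibre. So the sum is a full fibre sum of `g`.
  -- Otherwise no exponent qualifies.
  by_cases hw : d + m.degree = D ∧ wt n m ≤ w
  · rw [← coeffSum_weight_eq_zero (w - wt n m) hg]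
    refine coeffSum_congr fun u hu => ?_
    have h1 : d ≤ u.degree := sInf_le_degree hu
    have h2 := hD (m + u)
    simp only [Set.mem_ofPred_eq, wt_add, map_add] at h2 ⊢
    omega
  · refine coeffSum_eq_zero fun u _ => ?_
    simp only [Set.mem_ofPred_eq, wt_add, map_add]
    omega

/-- A monomial in the ideal of least homogeneous summands does not have maximal degree in its
fibre. -/
lemma exists_degree_lt_of_monomial_mem {n : Fin 4 → ℕ} {u : Fin 4 →₀ ℕ}
    (hu : (monomial u 1 : MvPolynomial (Fin 4) K) ∈ lowestFormIdeal (toricIdeal K n)) :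
    ∃ v, wt n v = wt n u ∧ u.degree < v.degree := by
  by_contra! h
  have := coeffSum_eq_zero_of_mem_lowestFormIdeal h hu
  simp [coeffSum_monomial] at this

lemma lowestForm_add {g h : MvPolynomial (Fin 4) K} {d : ℕ} (hg : g.IsHomogeneous d) (hg0 : g ≠ 0)
    (hh : ∀ u ∈ h.support, d < u.degree) : lowestForm (g + h) = g := by
  have key : ∀ e ≤ d, homogeneousComponent e (g + h) = if e = d then g else 0 := by
    intro e he
    have : homogeneousComponent e h = 0 := by
      ext u
      rw [coeff_homogeneousComponent, coeff_zero]
      split_ifs with hu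
      · by_contra hc
        have := hh u (mem_support_iff.2 hc)
        omega
      · rfl
    rw [map_add, this, add_zero, homogeneousComponent_of_mem hg]
  have hd : sInf {e : ℕ | homogeneousComponent e (g + h) ≠ 0} = d := by
    refine le_antisymm (Nat.sInf_le ?_) (le_csInf ⟨d, ?_⟩ fun e he => ?_)
    · rw [Set.mem_ofPred_eq, key d le_rfl, if_pos rfl]; exact hg0
    · rw [Set.mem_ofPred_eq, key d le_rfl, if_pos rfl]; exact hg0
    · by_contra! hlt
      exact he (by rw [key e hlt.le, if_neg hlt.ne])
  rw [lowestForm, hd, key d le_rfl, if_pos rfl]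

lemma monomial_mem_lowestFormIdeal {n : Fin 4 → ℕ} {p q : Fin 4 →₀ ℕ} (hw : wt n p = wt n q)
    (hd : p.degree < q.degree) :
    (monomial p 1 : MvPolynomial (Fin 4) K) ∈ lowestFormIdeal (toricIdeal K n) := by
  refine Ideal.subset_span ⟨_, binomial_mem_toricIdeal.2 hw, ?_⟩
  rw [sub_eq_add_neg]
  refine lowestForm_add (isHomogeneous_monomial _ rfl) (by simp) fun u hu => ?_
  have := support_monomial_subset (by rwa [support_neg] at hu)
  rwa [Finset.mem_singleton.1 this]

lemma binomial_mem_lowestFormIdeal {n : Fin 4 → ℕ} {p q : Fin 4 →₀ ℕ} (hw : wt n p = wt n q)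
    (hd : p.degree = q.degree) :
    (monomial p 1 - monomial q 1 : MvPolynomial (Fin 4) K) ∈
      lowestFormIdeal (toricIdeal K n) := by
  by_cases h0 : (monomial p 1 - monomial q 1 : MvPolynomial (Fin 4) K) = 0
  · rw [h0]; exact zero_mem _
  refine Ideal.subset_span ⟨_, binomial_mem_toricIdeal.2 hw, ?_⟩
  have := lowestForm_add (h := 0) ((isHomogeneous_monomial (R := K) 1 rfl).sub
    (isHomogeneous_monomial 1 hd.symm)) h0 (by simp)
  rwa [add_zero] at this

end

noncomputable section

variable {K : Type*} [Field K]

/-! ### The monomial order -/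

/-- The linear order whose reverse is the negative degree reverse lexicographic order. -/
def orderKey (u : Fin 4 →₀ ℕ) : ℕ ×ₗ Lex (Fin 4 →₀ ℕ) := toLex (u.degree, toLex u)

lemma negDegRevLexGT_iff {u v : Fin 4 →₀ ℕ} : NegDegRevLexGT u v ↔ orderKey u < orderKey v := by
  rw [orderKey, orderKey, Prod.Lex.toLex_lt_toLex]
  rfl

lemma orderKey_le_degree {u v : Fin 4 →₀ ℕ} (h : orderKey u ≤ orderKey v) :
    u.degree ≤ v.degree := by
  rw [orderKey, orderKey, Prod.Lex.toLex_le_toLex] at h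
  rcases h with h | h
  · exact h.le
  · exact h.1.le

lemma NegDegRevLexGT.add_left {u v : Fin 4 →₀ ℕ} (h : NegDegRevLexGT u v) (m : Fin 4 →₀ ℕ) :
    NegDegRevLexGT (m + u) (m + v) := by
  simpa [NegDegRevLexGT] using h

/-- The order is local, so descending chains of monomials can be infinite; finiteness of fibres is
what makes reduction terminate. -/
lemma finite_fibre {n : Fin 4 → ℕ} (hn : ∀ i, 0 < n i) (w : ℕ) :
    {u : Fin 4 →₀ ℕ | wt n u = w}.Finite := by
  refine (Set.finite_Iic (Finsupp.equivFunOnFinite.symm fun _ : Fin 4 => w)).subset ?_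
  rintro u rfl i
  calc u i ≤ u i * n i := Nat.le_mul_of_pos_right _ (hn i)
    _ ≤ wt n u := Finset.single_le_sum (f := fun i => u i * n i) (fun _ _ => Nat.zero_le _)
      (Finset.mem_univ i)

/-! ### Binomials with one standard monomial in every fibre -/

/-- An exponent is standard if its monomial is divisible by none of the monomials `x ^ p i`. -/
def IsStandard {ι : Type*} (p : ι → Fin 4 →₀ ℕ) (u : Fin 4 →₀ ℕ) : Prop := ∀ i, ¬ p i ≤ u

section
variable {n : Fin 4 → ℕ} {ι : Type*} {p q : ι → Fin 4 →₀ ℕ}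

/-- Reduction of exponents along the binomials `x ^ p i - x ^ q i`. -/
lemma reduction_induction (hn : ∀ i, 0 < n i) (hw : ∀ i, wt n (p i) = wt n (q i))
    (hlt : ∀ i, NegDegRevLexGT (p i) (q i)) {P : (Fin 4 →₀ ℕ) → Prop}
    (hs : ∀ u, IsStandard p u → P u) (hr : ∀ m i, P (m + q i) → P (m + p i)) (u : Fin 4 →₀ ℕ) :
    P u := by
  by_contra hu
  -- A counterexample with largest key, that is, smallest in the monomial order: a reduction step
  -- raises the key and would give a further one.
  obtain ⟨s, hs1, hs2⟩ := Set.Finite.exists_maximalFor orderKey {v | wt n v = wt n u ∧ ¬ P v}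
    ((finite_fibre hn (wt n u)).subset fun v hv => hv.1) ⟨u, rfl, hu⟩
  have hns : ¬ IsStandard p s := fun h => hs1.2 (hs s h)
  simp only [IsStandard, not_forall, not_not] at hns
  obtain ⟨i, hi⟩ := hns
  obtain ⟨m, rfl⟩ := exists_add_of_le hi
  rw [add_comm] at hs1 hs2
  have hk := negDegRevLexGT_iff.1 ((hlt i).add_left m)
  have hin : m + q i ∈ {v | wt n v = wt n u ∧ ¬ P v} :=
    ⟨by rw [← hs1.1, wt_add, wt_add, hw], fun h => hs1.2 (hr m i h)⟩
  exact absurd (hs2 hin hk.le) (not_le.2 hk)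

/-- Reduction only raises the key and ends at the one standard exponent of the fibre, which
therefore has the largest key and in particular the largest degree. -/
lemma orderKey_le_of_isStandard (hn : ∀ i, 0 < n i) (hw : ∀ i, wt n (p i) = wt n (q i))
    (hlt : ∀ i, NegDegRevLexGT (p i) (q i))
    (hu : ∀ u v, IsStandard p u → IsStandard p v → wt n u = wt n v → u = v)
    {u : Fin 4 →₀ ℕ} (hs : IsStandard p u) (v : Fin 4 →₀ ℕ) :
    wt n v = wt n u → orderKey v ≤ orderKey u := by
  refine reduction_induction hn hw hlt (P := fun v => wt n v = wt n u → orderKey v ≤ orderKey u)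
    (fun v hv h => (hu v u hv hs h) ▸ le_rfl) (fun m i ih h => ?_) v
  refine (negDegRevLexGT_iff.1 ((hlt i).add_left m)).le.trans (ih ?_)
  rw [← h, wt_add, wt_add, hw]

/-- If a leading exponent `α` of `f` in the toric ideal were standard, the other exponents of its
fibre would have no larger key, while the other terms of `f` have larger keys. So `α` would be the
only term of `f` in its fibre, and the vanishing fibre sum would be its coefficient. -/
lemma isStandardBasis_of_isStandard_unique (hn : ∀ i, 0 < n i)
    (hw : ∀ i, wt n (p i) = wt n (q i)) (hlt : ∀ i, NegDegRevLexGT (p i) (q i))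
    (hu : ∀ u v, IsStandard p u → IsStandard p v → wt n u = wt n v → u = v)
    {G : Set (MvPolynomial (Fin 4) K)} (hfin : G.Finite) (hsub : G ⊆ toricIdeal K n)
    (hG : ∀ i, ∃ g ∈ G, IsLeadingExponent g (p i)) :
    IsStandardBasis (toricIdeal K n) G := by
  refine ⟨hfin, hsub, le_antisymm (Ideal.span_mono ?_) (Ideal.span_le.2 ?_)⟩
  · rintro _ ⟨f, hf, h⟩
    exact ⟨f, hsub hf, h⟩
  · rintro _ ⟨f, hf, α, hα, rfl⟩
    have hns : ¬ IsStandard p α := by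
      intro hs
      have h0 := coeffSum_weight_eq_zero (wt n α) hf
      have h1 : coeffSum {u | wt n u = wt n α} f = coeff α f := by
        rw [← coeffSum_singleton]
        refine coeffSum_congr fun u hu' => ⟨fun h => ?_, ?_⟩
        · by_contra hne
          exact absurd (orderKey_le_of_isStandard hn hw hlt hu hs u h)
            (not_le.2 (negDegRevLexGT_iff.1 (hα.2 u hu' hne)))
        · rintro rfl; rfl
      exact mem_support_iff.1 hα.1 (h1 ▸ h0)
    simp only [IsStandard, not_forall, not_not] at hns
    obtain ⟨i, hi⟩ := hns
    obtain ⟨m, rfl⟩ := exists_add_of_le hi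
    obtain ⟨g, hg, hgp⟩ := hG i
    have : (monomial (p i + m) 1 : MvPolynomial (Fin 4) K) = monomial m 1 * monomial (p i) 1 := by
      rw [monomial_mul, one_mul, add_comm]
    rw [this]
    exact Ideal.mul_mem_left _ _ (Ideal.subset_span ⟨g, hg, _, hgp, rfl⟩)

/-- Reduce modulo `J` to a combination of standard monomials. By uniqueness each of its coefficients
is a top-degree fibre sum, and such sums vanish on the ideal of least forms. -/
lemma lowestFormIdeal_eq_of_isStandard_unique (hn : ∀ i, 0 < n i)
    (hw : ∀ i, wt n (p i) = wt n (q i)) (hlt : ∀ i, NegDegRevLexGT (p i) (q i))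
    (hu : ∀ u v, IsStandard p u → IsStandard p v → wt n u = wt n v → u = v)
    {J : Ideal (MvPolynomial (Fin 4) K)} (hJ : J ≤ lowestFormIdeal (toricIdeal K n))
    (hp : ∀ i, (monomial (p i) 1 : MvPolynomial (Fin 4) K) ∈ J ∨
      (monomial (p i) 1 - monomial (q i) 1 : MvPolynomial (Fin 4) K) ∈ J) :
    J = lowestFormIdeal (toricIdeal K n) := by
  classical
  refine le_antisymm hJ fun f hf => ?_
  have hred : ∀ u, ∃ r : MvPolynomial (Fin 4) K, (∀ x ∈ r.support, IsStandard p x) ∧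
      monomial u 1 - r ∈ J := by
    refine reduction_induction hn hw hlt (fun u hs => ?_) ?_
    · refine ⟨monomial u 1, fun x hx => ?_, by simp⟩
      rwa [Finset.mem_singleton.1 (support_monomial_subset hx)]
    · rintro m i ⟨r, hr, hrJ⟩
      rcases hp i with h | h
      · refine ⟨0, by simp, ?_⟩
        have := J.mul_mem_left (monomial m 1) h
        rwa [monomial_mul, one_mul, ← sub_zero (monomial _ _)] at this
      · refine ⟨r, hr, ?_⟩
        have := J.add_mem (J.mul_mem_left (monomial m 1) h) hrJ
        rw [mul_sub, monomial_mul, monomial_mul, one_mul] at this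
        simpa using this
  have hall : ∀ g : MvPolynomial (Fin 4) K, ∃ r : MvPolynomial (Fin 4) K,
      (∀ x ∈ r.support, IsStandard p x) ∧ g - r ∈ J := by
    intro g
    have hmon : ∀ u (c : K), ∃ r : MvPolynomial (Fin 4) K,
        (∀ x ∈ r.support, IsStandard p x) ∧ monomial u c - r ∈ J := by
      intro u c
      obtain ⟨r, hr, hrJ⟩ := hred u
      refine ⟨C c * r, fun x hx => hr x ?_, ?_⟩
      · rw [mem_support_iff, coeff_C_mul] at hx
        exact mem_support_iff.2 (right_ne_zero_of_mul hx)
      · have := J.mul_mem_left (C c) hrJ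
        rwa [mul_sub, C_mul_monomial, mul_one] at this
    induction g using MvPolynomial.monomial_add_induction_on with
    | C c => exact hmon 0 c
    | monomial_add u c g _ _ ih =>
      obtain ⟨r, hr, hrJ⟩ := hmon u c
      obtain ⟨s, hs, hsJ⟩ := ih
      refine ⟨r + s, fun x hx => ?_, ?_⟩
      · rcases Finset.mem_union.1 (support_add hx) with h | h
        · exact hr x h
        · exact hs x h
      · rw [add_sub_add_comm]
        exact J.add_mem hrJ hsJ
  obtain ⟨r, hr, hrJ⟩ := hall f
  have hrI : r ∈ lowestFormIdeal (toricIdeal K n) := by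
    have := Ideal.sub_mem _ hf (hJ hrJ)
    rwa [sub_sub_cancel] at this
  have hr0 : r = 0 := by
    ext s
    rw [coeff_zero]
    by_contra hc
    have hs : IsStandard p s := hr s (mem_support_iff.2 hc)
    refine hc ?_
    rw [← coeffSum_eq_zero_of_mem_lowestFormIdeal (w := wt n s) (D := s.degree)
      (fun u h => orderKey_le_degree (orderKey_le_of_isStandard hn hw hlt hu hs u h)) hrI,
      ← coeffSum_singleton]
    refine coeffSum_congr fun u hu' => ⟨?_, fun h => hu u s (hr u hu') hs h.1⟩
    rintro rfl
    exact ⟨rfl, rfl⟩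
  rwa [hr0, sub_zero] at hrJ

end

/-- `g i` is not in the ideal of the others if one of its terms is divisible by no term of the
others. -/
lemma notMem_span_image_compl {ι : Type*} {g : ι → MvPolynomial (Fin 4) K} {i : ι}
    {s : Fin 4 →₀ ℕ} (hs : coeff s (g i) ≠ 0) (h : ∀ j ≠ i, ∀ u ∈ (g j).support, ¬ u ≤ s) :
    g i ∉ Ideal.span (g '' {i}ᶜ) := by
  intro hmem
  refine hs ?_
  rw [← coeffSum_singleton]
  refine coeffSum_eq_zero_of_mem_span ?_ hmem
  rintro _ ⟨j, hj, rfl⟩ m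
  rw [coeffSum_monomial_mul]
  refine coeffSum_eq_zero fun u hu h1 => h j hj u hu ?_
  have h2 : m + u = s := h1
  exact h2 ▸ le_add_self

end

noncomputable section

/-! ### Cohen–Macaulay tangent cones -/

/-- If a prime `P` of a Cohen–Macaulay ring contains an element that is not nilpotent in the
localization at `P`, then an element annihilated by `P` is zero in the localization. -/
lemma IsCohenMacaulayRing.exists_mul_eq_zero {A : Type*} [CommRing A] (hA : IsCohenMacaulayRing A)
    (P : Ideal A) [P.IsPrime] {x : A} (hx : x ∈ P) (hnil : ∀ s ∉ P, ∀ k : ℕ, s * x ^ k ≠ 0)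
    {y : A} (hy : ∀ z ∈ P, z * y = 0) : ∃ s ∉ P, s * y = 0 := by
  obtain ⟨_, rs, hrs, hreg, hlen⟩ := hA.2 P
  cases rs with
  | nil =>
    -- An empty regular sequence means dimension zero, and then `x` would be nilpotent in the
    -- localization.
    exfalso
    have : Ring.KrullDimLE 0 (Localization.AtPrime P) := Ring.krullDimLE_iff.2 (by rw [← hlen]; simp)
    have hmem : algebraMap A (Localization.AtPrime P) x ∈ IsLocalRing.maximalIdeal (Localization.AtPrime P) :=
      (IsLocalization.AtPrime.to_map_mem_maximal_iff (Localization.AtPrime P) P x).2 hx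
    obtain ⟨k, hk⟩ := Ring.KrullDimLE.isNilpotent_iff_mem_maximalIdeal.2 hmem
    rw [← map_pow, IsLocalization.map_eq_zero_iff P.primeCompl] at hk
    obtain ⟨s, hs⟩ := hk
    exact hnil s s.2 k hs
  | cons r rs =>
    have hr : r ∈ IsLocalRing.maximalIdeal (Localization.AtPrime P) := hrs r (by simp)
    have hsmul : IsSMulRegular (Localization.AtPrime P) r :=
      ((RingTheory.Sequence.isWeaklyRegular_cons_iff (Localization.AtPrime P) r rs).1 hreg.toIsWeaklyRegular).1
    obtain ⟨a, s, rfl⟩ := IsLocalization.exists_mk'_eq P.primeCompl r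
    have ha : a ∈ P := (IsLocalization.AtPrime.mk'_mem_maximal_iff (Localization.AtPrime P) P a s).1 hr
    -- The first member of the regular sequence comes from `P`, so it annihilates `y`, yet it is a
    -- nonzerodivisor.
    have h0 : algebraMap A (Localization.AtPrime P) y = 0 := by
      refine hsmul ?_
      simp only [smul_eq_mul, mul_zero]
      rw [mul_comm, IsLocalization.mul_mk'_eq_mk'_of_mul, mul_comm, hy a ha,
        IsLocalization.mk'_zero]
    rw [IsLocalization.map_eq_zero_iff P.primeCompl] at h0
    obtain ⟨s, hs⟩ := h0
    exact ⟨s, s.2, hs⟩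

variable {K : Type*} [Field K] {n : Fin 4 → ℕ}

lemma degree_mul_le_wt (hn : ∀ i, n 0 ≤ n i) (u : Fin 4 →₀ ℕ) : u.degree * n 0 ≤ wt n u := by
  rw [Finsupp.degree_eq_sum, wt, Finset.sum_mul]
  exact Finset.sum_le_sum fun i _ => Nat.mul_le_mul_left _ (hn i)

lemma eq_zero_of_wt_eq_zero (hn : ∀ i, 0 < n i) {u : Fin 4 →₀ ℕ} (h : wt n u = 0) : u = 0 := by
  ext i
  have := Finset.sum_eq_zero_iff.1 h i (Finset.mem_univ i)
  simpa [(hn i).ne'] using this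

/-- If `Y` is nilpotent modulo `J`, then outside `J` there are multiples annihilated by `Y`. -/
lemma exists_pow_mul_notMem {R : Type*} [CommRing R] {J : Ideal R} {Y f : R} {N : ℕ}
    (hY : Y ^ N ∈ J) (hf : f ∉ J) : ∃ k, Y ^ k * f ∉ J ∧ Y * (Y ^ k * f) ∈ J := by
  classical
  have hex : ∃ k, Y ^ k * f ∈ J := ⟨N, J.mul_mem_right _ hY⟩
  obtain ⟨k, hk⟩ : ∃ k, Nat.find hex = k + 1 := Nat.exists_eq_succ_of_ne_zero fun h => hf (by
    simpa [h] using Nat.find_spec hex)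
  refine ⟨k, Nat.find_min hex (by omega), ?_⟩
  have := Nat.find_spec hex
  rwa [hk, pow_succ', mul_assoc] at this

/-- If the tangent cone is Cohen–Macaulay, then `x₁` is a nonzerodivisor on its coordinate ring. -/
lemma HasCohenMacaulayTangentCone.mem_of_X_mul_mem (hCM : HasCohenMacaulayTangentCone K n)
    (hpos : 0 < n 0) (hmono : StrictMono n) {f : MvPolynomial (Fin 4) K}
    (hf : X 0 * f ∈ lowestFormIdeal (toricIdeal K n)) :
    f ∈ lowestFormIdeal (toricIdeal K n) := by
  have hle : ∀ i, n 0 ≤ n i := fun i => hmono.monotone (Fin.zero_le i)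
  have hn : ∀ i, 0 < n i := fun i => hpos.trans_le (hle i)
  set J := lowestFormIdeal (toricIdeal K n) with hJ
  by_contra hfJ
  -- `X i ^ n 0` and `X 0 ^ n i` have equal weight, and the latter has larger degree.
  have hX : ∀ i, i ≠ 0 → (X i : MvPolynomial (Fin 4) K) ^ n 0 ∈ J := by
    intro i hi
    rw [X_pow_eq_monomial]
    refine monomial_mem_lowestFormIdeal (q := Finsupp.single 0 (n i)) ?_ ?_
    · simp [wt, Finsupp.single_apply, mul_comm]
    · simpa using hmono (Fin.pos_of_ne_zero hi)
  -- Multiplying `f` by suitable powers of the nilpotent variables yields a `g` outside `J` that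
  -- every variable carries into `J`: a socle element, which Cohen–Macaulayness at the origin
  -- forbids.
  obtain ⟨k1, h1, h1'⟩ := exists_pow_mul_notMem (hX 1 (by decide)) hfJ
  obtain ⟨k2, h2, h2'⟩ := exists_pow_mul_notMem (hX 2 (by decide)) h1
  obtain ⟨k3, h3, h3'⟩ := exists_pow_mul_notMem (hX 3 (by decide)) h2
  set g := (X 3 : MvPolynomial (Fin 4) K) ^ k3 * (X 2 ^ k2 * (X 1 ^ k1 * f)) with hg
  have hXg : ∀ i, X i * g ∈ J := by
    intro i
    fin_cases i
    · have := J.mul_mem_left (X 3 ^ k3 * (X 2 ^ k2 * X 1 ^ k1)) hf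
      convert this using 1
      simp only [hg, Fin.zero_eta]; ring
    · have := J.mul_mem_left (X 3 ^ k3 * X 2 ^ k2) h1'
      convert this using 1
      simp only [hg, Fin.mk_one]; ring
    · have := J.mul_mem_left (X 3 ^ k3) h2'
      convert this using 1
      simp only [hg, Fin.reduceFinMk]; ring
    · exact h3'
  have hconst : ∀ h : MvPolynomial (Fin 4) K, h * g - C (constantCoeff h) * g ∈ J := by
    intro h
    induction h using MvPolynomial.induction_on with
    | C a => simp
    | add p q hp hq =>
      have := J.add_mem hp hq
      convert this using 1
      simp only [map_add]; ring
    | mul_X p i _ =>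
      have := J.mul_mem_left p (hXg i)
      simpa [mul_assoc] using this
  have hJc : ∀ h ∈ J, constantCoeff h = 0 := by
    intro h hh
    have h0 := coeffSum_eq_zero_of_mem_lowestFormIdeal (w := 0) (D := 0)
      (fun u hu => by rw [eq_zero_of_wt_eq_zero hn hu]; simp) hh
    rw [constantCoeff_eq, ← coeffSum_singleton, ← h0]
    refine coeffSum_congr fun u _ => ⟨?_, fun hu => eq_zero_of_wt_eq_zero hn hu.1⟩
    rintro rfl
    exact ⟨by simp [wt], by simp⟩
  set χ : MvPolynomial (Fin 4) K ⧸ J →+* K := Ideal.Quotient.lift J constantCoeff hJc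
  have hprime : (RingHom.ker χ).IsPrime := RingHom.ker_isPrime χ
  have hmem : ∀ h, Ideal.Quotient.mk J h ∈ RingHom.ker χ ↔ constantCoeff h = 0 := fun h => by
    rw [RingHom.mem_ker, Ideal.Quotient.lift_mk]
  obtain ⟨s, hs, hsg⟩ : ∃ s ∉ RingHom.ker χ, s * Ideal.Quotient.mk J g = 0 := by
    refine IsCohenMacaulayRing.exists_mul_eq_zero hCM (RingHom.ker χ)
      (x := Ideal.Quotient.mk J (X 0)) ((hmem _).2 (by simp)) (fun s hs k h0 => ?_)
      (fun z hz => ?_)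
    · obtain ⟨s, rfl⟩ := Ideal.Quotient.mk_surjective s
      rw [hmem] at hs
      rw [← map_pow, ← map_mul, Ideal.Quotient.eq_zero_iff_mem] at h0
      -- As `x₁` has the least weight, `k` is the maximal degree in the fibre of `x₁ ^ k`, attained
      -- there by `x₁ ^ k`. Among multiples of `x₁ ^ k` only this one qualifies, so the sum reads
      -- off the constant term of `s`.
      have h6 := coeffSum_eq_zero_of_mem_lowestFormIdeal (w := k * n 0) (D := k)
        (fun u hu => Nat.le_of_mul_le_mul_right (hu ▸ degree_mul_le_wt hle u) hpos) h0
      rw [mul_comm s, X_pow_eq_monomial, coeffSum_monomial_mul] at h6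
      refine hs ?_
      rw [constantCoeff_eq, ← coeffSum_singleton, ← h6]
      refine coeffSum_congr fun u _ => ⟨?_, fun hu => ?_⟩
      · rintro rfl
        refine ⟨?_, by simp⟩
        simp [wt, Finsupp.single_apply]
      · have := hu.2
        rw [map_add, Finsupp.degree_single] at this
        exact (Finsupp.degree_eq_zero_iff u).1 (by omega)
    · obtain ⟨z, rfl⟩ := Ideal.Quotient.mk_surjective z
      rw [hmem] at hz
      have := hconst z
      rw [hz, C_0, zero_mul, sub_zero] at this
      rwa [← map_mul, Ideal.Quotient.eq_zero_iff_mem]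
  obtain ⟨s, rfl⟩ := Ideal.Quotient.mk_surjective s
  rw [hmem] at hs
  rw [← map_mul, Ideal.Quotient.eq_zero_iff_mem] at hsg
  have h4 := J.sub_mem hsg (hconst s)
  rw [sub_sub_cancel] at h4
  have h5 := J.mul_mem_left (C (constantCoeff s)⁻¹) h4
  rw [← mul_assoc, ← C_mul, inv_mul_cancel₀ hs, C_1, one_mul] at h5
  exact h3 h5

lemma HasCohenMacaulayTangentCone.monomial_mem (hCM : HasCohenMacaulayTangentCone K n)
    (hpos : 0 < n 0) (hmono : StrictMono n) {k : ℕ} {u : Fin 4 →₀ ℕ}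
    (hu : (monomial (Finsupp.single 0 k + u) 1 : MvPolynomial (Fin 4) K) ∈
      lowestFormIdeal (toricIdeal K n)) :
    (monomial u 1 : MvPolynomial (Fin 4) K) ∈ lowestFormIdeal (toricIdeal K n) := by
  induction k with
  | zero => simpa using hu
  | succ k ih =>
    refine ih (hCM.mem_of_X_mul_mem hpos hmono ?_)
    convert hu using 1
    rw [X, monomial_mul, one_mul, ← add_assoc, ← Finsupp.single_add, add_comm 1 k]

end

noncomputable section

/-! ### The binomials of case 2(a) -/

/-- The exponent of `x₁ ^ b₀ x₂ ^ b₁ x₃ ^ b₂ x₄ ^ b₃`. -/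
def expo (b₀ b₁ b₂ b₃ : ℕ) : Fin 4 →₀ ℕ := Finsupp.equivFunOnFinite.symm ![b₀, b₁, b₂, b₃]

section
variable (b₀ b₁ b₂ b₃ : ℕ)

@[simp] lemma expo_zero : expo b₀ b₁ b₂ b₃ 0 = b₀ := rfl
@[simp] lemma expo_one : expo b₀ b₁ b₂ b₃ 1 = b₁ := rfl
@[simp] lemma expo_two : expo b₀ b₁ b₂ b₃ 2 = b₂ := rfl
@[simp] lemma expo_three : expo b₀ b₁ b₂ b₃ 3 = b₃ := rfl

lemma wt_expo (n : Fin 4 → ℕ) :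
    wt n (expo b₀ b₁ b₂ b₃) = b₀ * n 0 + b₁ * n 1 + b₂ * n 2 + b₃ * n 3 := by
  simp [wt, Fin.sum_univ_four]

lemma degree_expo : (expo b₀ b₁ b₂ b₃).degree = b₀ + b₁ + b₂ + b₃ := by
  simp [Finsupp.degree_eq_sum, Fin.sum_univ_four]

lemma monomial_expo {K : Type*} [Field K] : (monomial (expo b₀ b₁ b₂ b₃) 1 : MvPolynomial (Fin 4) K)
    = X 0 ^ b₀ * X 1 ^ b₁ * X 2 ^ b₂ * X 3 ^ b₃ := by
  rw [monomial_eq, Finsupp.prod_fintype _ _ (by simp), Fin.prod_univ_four]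
  simp

end

lemma le_iff_apply {u v : Fin 4 →₀ ℕ} :
    u ≤ v ↔ u 0 ≤ v 0 ∧ u 1 ≤ v 1 ∧ u 2 ≤ v 2 ∧ u 3 ≤ v 3 := by
  simp [Finsupp.le_def, Fin.forall_fin_succ]

lemma eq_expo (u : Fin 4 →₀ ℕ) : u = expo (u 0) (u 1) (u 2) (u 3) := by
  ext i; fin_cases i <;> rfl

lemma negDegRevLexGT_of_degree_le {u v : Fin 4 →₀ ℕ} (h : u.degree ≤ v.degree)
    (h' : u.degree = v.degree → u 0 < v 0) : NegDegRevLexGT u v := by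
  rcases h.lt_or_eq with h | h
  · exact Or.inl h
  · exact Or.inr ⟨h, 0, fun j hj => absurd hj (Fin.not_lt_zero j), h' h⟩

variable {K : Type*} [Field K]

lemma isLeadingExponent_binomial {p q : Fin 4 →₀ ℕ} (h : NegDegRevLexGT p q)
    {g : MvPolynomial (Fin 4) K}
    (hg : g = monomial p 1 - monomial q 1 ∨ g = monomial q 1 - monomial p 1) :
    IsLeadingExponent g p := by
  classical
  have hne : q ≠ p := by
    rintro rfl
    exact lt_irrefl _ (negDegRevLexGT_iff.1 h)
  constructor
  · rcases hg with rfl | rfl <;> simp [mem_support_iff, coeff_sub, coeff_monomial, hne]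
  · intro β hβ hβp
    have : β = q := by
      by_contra hβq
      rcases hg with rfl | rfl <;>
        simp [mem_support_iff, coeff_sub, coeff_monomial, Ne.symm hβp, Ne.symm hβq] at hβ
    rwa [this]

namespace ExponentData

variable {a : ExponentData} {n : Fin 4 → ℕ}

variable (a) in
/-- The exponents of the first terms of `f₁, …, f₅`. -/
def firstExpo : Fin 5 → Fin 4 →₀ ℕ :=
  ![expo a.a1 0 0 0, expo 0 a.a2 0 0, expo 0 0 a.a3 0, expo 0 0 0 a.a4, expo a.a41 0 a.a23 0]

variable (a) in
/-- The exponents of the second terms of `f₁, …, f₅`. -/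
def secondExpo : Fin 5 → Fin 4 →₀ ℕ :=
  ![expo 0 a.a12 a.a13 0, expo 0 0 a.a23 a.a24, expo a.a31 0 0 a.a34, expo a.a41 a.a42 0 0,
    expo 0 a.a12 0 a.a34]

lemma IsCase2a.toricIdeal_eq (h : a.IsCase2a K n) : toricIdeal K n =
    Ideal.span (Set.range fun i => monomial (a.firstExpo i) 1 - monomial (a.secondExpo i) 1) := by
  obtain ⟨-, -, -, -, -, -, -, -, h, -⟩ := h
  rw [← h]
  congr 2
  funext i
  fin_cases i <;>
    simp [firstExpo, secondExpo, monomial_expo, f1, f2, f3, f4, f5]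

lemma IsCase2a.wt_eq (h : a.IsCase2a K n) (i : Fin 5) :
    wt n (a.firstExpo i) = wt n (a.secondExpo i) := by
  rw [← binomial_mem_toricIdeal (K := K), h.toricIdeal_eq]
  exact Ideal.subset_span ⟨i, rfl⟩

lemma IsCase2a.weights (h : a.IsCase2a K n) :
    a.a1 * n 0 = a.a12 * n 1 + a.a13 * n 2 ∧ a.a2 * n 1 = a.a23 * n 2 + a.a24 * n 3 ∧
    a.a3 * n 2 = a.a31 * n 0 + a.a34 * n 3 ∧ a.a4 * n 3 = a.a41 * n 0 + a.a42 * n 1 ∧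
    a.a41 * n 0 + a.a23 * n 2 = a.a12 * n 1 + a.a34 * n 3 := by
  have h0 := h.wt_eq 0
  have h1 := h.wt_eq 1
  have h2 := h.wt_eq 2
  have h3 := h.wt_eq 3
  have h4 := h.wt_eq 4
  simp [firstExpo, secondExpo, wt_expo] at h0 h1 h2 h3 h4
  exact ⟨h0, h1, h2, h3, h4⟩

lemma IsCase2a.eq_of_wt_eq (h : a.IsCase2a K n) {b₀ b₁ b₂ b₃ c₀ c₁ c₂ c₃ : ℕ}
    (hs : ∀ i, ¬ a.firstExpo i ≤ expo b₀ b₁ b₂ b₃ ∧ ¬ a.secondExpo i ≤ expo b₀ b₁ b₂ b₃)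
    (hw : b₀ * n 0 + b₁ * n 1 + b₂ * n 2 + b₃ * n 3 =
      c₀ * n 0 + c₁ * n 1 + c₂ * n 2 + c₃ * n 3) :
    c₀ = b₀ ∧ c₁ = b₁ ∧ c₂ = b₂ ∧ c₃ = b₃ := by
  have := eq_of_wt_eq_of_not_le h.toricIdeal_eq (v := expo c₀ c₁ c₂ c₃) hs
    (by rw [wt_expo, wt_expo, hw])
  exact ⟨DFunLike.congr_fun this 0, DFunLike.congr_fun this 1, DFunLike.congr_fun this 2,
    DFunLike.congr_fun this 3⟩

/-- Combining `f₅` with one of `f₁, …, f₄`, or two of those, shows that a pure power with the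
exponent on the right shares its fibre with another monomial. It would be alone there if the
exponent were below `a_i`, so `≤` holds in each relation. Adding the weights of `f₁, …, f₄` forces
equality in all four. -/
lemma IsCase2a.relations (h : a.IsCase2a K n) (hn : ∀ i, 0 < n i) :
    a.a1 = a.a31 + a.a41 ∧ a.a2 = a.a12 + a.a42 ∧ a.a3 = a.a13 + a.a23 ∧
    a.a4 = a.a24 + a.a34 := by
  obtain ⟨w1, w2, w3, w4, w5⟩ := h.weights
  obtain ⟨h12, h13, h23, h24, h31, h34, h41, h42, -⟩ := id h
  have l3 : a.a3 ≤ a.a13 + a.a23 := by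
    -- The competitor is `x₁ ^ (a₁ - a₄₁) x₄ ^ a₃₄`, obtained from `f₁` and `f₅`; `c + 1` stands for
    -- `a₁ - a₄₁`.
    by_contra! hlt
    obtain ⟨c, hc⟩ := Nat.exists_eq_add_of_lt h41.2
    have := h.eq_of_wt_eq (b₀ := 0) (b₁ := 0) (b₂ := a.a13 + a.a23) (b₃ := 0) (c₀ := c + 1)
      (c₁ := 0) (c₂ := 0) (c₃ := a.a34)
      (by simp [Fin.forall_fin_succ, firstExpo, secondExpo, le_iff_apply]; omega)
      (by rw [hc] at w1; linarith)
    omega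
  have l4 : a.a4 ≤ a.a24 + a.a34 := by
    by_contra! hlt
    -- From `f₂` and `f₅`, with `c + 1 = a₂ - a₁₂`.
    obtain ⟨c, hc⟩ := Nat.exists_eq_add_of_lt h12.2
    have := h.eq_of_wt_eq (b₀ := 0) (b₁ := 0) (b₂ := 0) (b₃ := a.a24 + a.a34) (c₀ := a.a41)
      (c₁ := c + 1) (c₂ := 0) (c₃ := 0)
      (by simp [Fin.forall_fin_succ, firstExpo, secondExpo, le_iff_apply]; omega)
      (by rw [hc] at w2; linarith)
    omega
  have l1 : a.a1 ≤ a.a31 + a.a41 := by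
    by_contra! hlt
    -- From `f₃` and `f₅`, with `c + 1 = a₃ - a₂₃`.
    obtain ⟨c, hc⟩ := Nat.exists_eq_add_of_lt h23.2
    have := h.eq_of_wt_eq (b₀ := a.a31 + a.a41) (b₁ := 0) (b₂ := 0) (b₃ := 0) (c₀ := 0)
      (c₁ := a.a12) (c₂ := c + 1) (c₃ := 0)
      (by simp [Fin.forall_fin_succ, firstExpo, secondExpo, le_iff_apply]; omega)
      (by rw [hc] at w3; linarith)
    omega
  have l2 : a.a2 ≤ a.a12 + a.a42 := by
    by_contra! hlt
    -- From `f₄` and `f₅`, with `c + 1 = a₄ - a₃₄`.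
    obtain ⟨c, hc⟩ := Nat.exists_eq_add_of_lt h34.2
    have := h.eq_of_wt_eq (b₀ := 0) (b₁ := a.a12 + a.a42) (b₂ := 0) (b₃ := 0) (c₀ := 0)
      (c₁ := 0) (c₂ := a.a23) (c₃ := c + 1)
      (by simp [Fin.forall_fin_succ, firstExpo, secondExpo, le_iff_apply]; omega)
      (by rw [hc] at w4; linarith)
    omega
  obtain ⟨d1, e1⟩ := Nat.exists_eq_add_of_le l1
  obtain ⟨d2, e2⟩ := Nat.exists_eq_add_of_le l2
  obtain ⟨d3, e3⟩ := Nat.exists_eq_add_of_le l3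
  obtain ⟨d4, e4⟩ := Nat.exists_eq_add_of_le l4
  have hsum : d1 * n 0 + d2 * n 1 + d3 * n 2 + d4 * n 3 = 0 := by
    have k1 := congrArg (· * n 0) e1
    have k2 := congrArg (· * n 1) e2
    have k3 := congrArg (· * n 2) e3
    have k4 := congrArg (· * n 3) e4
    simp only [add_mul] at k1 k2 k3 k4
    omega
  have z1 := (hn 0).ne'
  have z2 := (hn 1).ne'
  have z3 := (hn 2).ne'
  have z4 := (hn 3).ne'
  simp [z1, z2, z3, z4] at hsum
  omega

variable (a) in
/-- The normal form, modulo `x₁` and `f₁, …, f₅`, of the monomial with exponent `u`; it is `none`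
if that monomial is zero modulo `x₁, f₁, …, f₅`. -/
def normalForm (u : Fin 4 →₀ ℕ) : Option (ℕ × ℕ × ℕ) :=
  -- Modulo `x₁` the binomials `f₁, f₃, f₄, f₅` become monomials, which give `none`; only `f₂` still
  -- rewrites. The later bound `a₂ + a₁₂` reflects `x₂ ^ (a₂ + a₁₂) ≡ x₂ ^ a₁₂ x₃ ^ a₂₃ x₄ ^ a₂₄`,
  -- which vanishes by `f₅` when `a₃₄ ≤ a₂₄`.
  if 0 < u 0 ∨ (a.a12 ≤ u 1 ∧ a.a13 ≤ u 2) ∨ a.a3 ≤ u 2 ∨ a.a4 ≤ u 3 ∨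
    (a.a12 ≤ u 1 ∧ a.a34 ≤ u 3) then none
  else if a.a23 ≤ u 2 ∧ a.a24 ≤ u 3 then some (u 1 + a.a2, u 2 - a.a23, u 3 - a.a24)
  else if a.a2 + a.a12 ≤ u 1 then none
  else some (u 1, u 2, u 3)

lemma IsCase2a.normalForm_eq (h : a.IsCase2a K n) (hn : ∀ i, 0 < n i) (h34 : a.a34 ≤ a.a24)
    {u v : Fin 4 →₀ ℕ} (huv : wt n u = wt n v) : a.normalForm u = a.normalForm v := by
  obtain ⟨r1, r2, r3, r4⟩ := h.relations hn
  obtain ⟨h12, h13, h23, h24, h31, h34', h41, h42, -⟩ := id h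
  refine _root_.eq_of_wt_eq h.toricIdeal_eq a.normalForm (fun i m => ?_) huv
  fin_cases i <;> simp [firstExpo, secondExpo, normalForm] <;>
    split_ifs <;> first | omega | simp

variable (a) in
/-- The leading exponents of `f₁, …, f₆`. -/
def leadExpo : Fin 6 → Fin 4 →₀ ℕ :=
  ![expo 0 a.a12 a.a13 0, expo 0 0 a.a23 a.a24, expo 0 0 a.a3 0, expo 0 0 0 a.a4,
    expo 0 a.a12 0 a.a34, expo 0 (a.a2 + a.a12) 0 0]

variable (a) in
/-- The other exponents of `f₁, …, f₆`, where `f₆ = x₂ ^ (a₂ + a₁₂) - x₁ ^ c₀ x₃ ^ c₂ x₄ ^ c₃`. -/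
def tailExpo (c₀ c₂ c₃ : ℕ) : Fin 6 → Fin 4 →₀ ℕ :=
  ![expo a.a1 0 0 0, expo 0 a.a2 0 0, expo a.a31 0 0 a.a34, expo a.a41 a.a42 0 0,
    expo a.a41 0 a.a23 0, expo c₀ 0 c₂ c₃]

lemma normalForm_of_isStandard {u : Fin 4 →₀ ℕ} (hu : IsStandard a.leadExpo u) (h0 : u 0 = 0) :
    a.normalForm u = some (u 1, u 2, u 3) := by
  simp [IsStandard, Fin.forall_fin_succ, leadExpo, le_iff_apply] at hu
  rw [normalForm, if_neg (by omega), if_neg (by omega), if_neg (by omega)]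

lemma IsCase2a.eq_of_isStandard (h : a.IsCase2a K n) (hn : ∀ i, 0 < n i) (h34 : a.a34 ≤ a.a24)
    (u v : Fin 4 →₀ ℕ) (hu : IsStandard a.leadExpo u) (hv : IsStandard a.leadExpo v)
    (huv : wt n u = wt n v) : u = v := by
  -- After dividing by `x₁ ^ k` at least one of the two is free of `x₁`. If only one is, its normal
  -- form is `some` and the other's is `none`.
  set k := min (u 0) (v 0)
  have hdrop : ∀ w : Fin 4 →₀ ℕ, k ≤ w 0 →
      w = expo k 0 0 0 + expo (w 0 - k) (w 1) (w 2) (w 3) := by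
    intro w hw
    ext i
    fin_cases i <;> simp [hw]
  have hku : k ≤ u 0 := min_le_left _ _
  have hkv : k ≤ v 0 := min_le_right _ _
  have hnf : a.normalForm (expo (u 0 - k) (u 1) (u 2) (u 3)) =
      a.normalForm (expo (v 0 - k) (v 1) (v 2) (v 3)) := by
    refine h.normalForm_eq hn h34 ?_
    rw [hdrop u hku, hdrop v hkv, wt_add, wt_add] at huv
    exact Nat.add_left_cancel huv
  have hstd : ∀ w : Fin 4 →₀ ℕ, IsStandard a.leadExpo w →
      IsStandard a.leadExpo (expo (w 0 - k) (w 1) (w 2) (w 3)) := by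
    intro w hw i hi
    refine hw i (hi.trans ?_)
    simp [le_iff_apply]
  have hnone : ∀ w : Fin 4 →₀ ℕ, 0 < w 0 → a.normalForm w = none := fun w hw =>
    if_pos (Or.inl hw)
  by_cases hu0 : u 0 - k = 0 <;> by_cases hv0 : v 0 - k = 0
  · rw [normalForm_of_isStandard (hstd u hu) hu0, normalForm_of_isStandard (hstd v hv) hv0] at hnf
    simp at hnf
    rw [eq_expo u, eq_expo v]
    congr 1
    · omega
    · exact hnf.1
    · exact hnf.2.1
    · exact hnf.2.2
  · rw [normalForm_of_isStandard (hstd u hu) hu0, hnone _ (Nat.pos_of_ne_zero hv0)] at hnf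
    simp at hnf
  · rw [normalForm_of_isStandard (hstd v hv) hv0, hnone _ (Nat.pos_of_ne_zero hu0)] at hnf
    simp at hnf
  · omega

end ExponentData

end

/-! ### Degree inequalities, the standard basis and the tangent cone of case 2(a) -/

noncomputable section

namespace ExponentData

variable {K : Type*} [Field K] {a : ExponentData} {n : Fin 4 → ℕ}

/-- If the tangent cone is Cohen–Macaulay, then `x₁ ^ k s` has maximal degree in its fibre if `s` is
alone in its fibre. -/
lemma IsCase2a.degree_le (h : a.IsCase2a K n) (hCM : HasCohenMacaulayTangentCone K n)
    (hpos : 0 < n 0) (hmono : StrictMono n) {p s : Fin 4 →₀ ℕ} {k : ℕ}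
    (hw : wt n p = wt n (Finsupp.single 0 k + s))
    (hs : ∀ i, ¬ a.firstExpo i ≤ s ∧ ¬ a.secondExpo i ≤ s) : p.degree ≤ k + s.degree := by
  by_contra! hlt
  have hmem := hCM.monomial_mem hpos hmono (u := s) (k := k)
    (monomial_mem_lowestFormIdeal hw.symm (by simpa using hlt))
  obtain ⟨v, hv, hdeg⟩ := exists_degree_lt_of_monomial_mem hmem
  rw [eq_of_wt_eq_of_not_le h.toricIdeal_eq hs hv.symm] at hdeg
  exact lt_irrefl _ hdeg

lemma IsCase2a.a3_le (h : a.IsCase2a K n) (hCM : HasCohenMacaulayTangentCone K n)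
    (hpos : 0 < n 0) (hmono : StrictMono n) : a.a3 ≤ a.a31 + a.a34 := by
  obtain ⟨-, -, w3, -, -⟩ := h.weights
  obtain ⟨h12, h13, h23, h24, h31, h34, h41, h42, -⟩ := id h
  have := h.degree_le hCM hpos hmono (p := expo 0 0 a.a3 0) (s := expo 0 0 0 a.a34) (k := a.a31)
    (by rw [wt_add, wt_expo, wt_expo]; simpa [wt, Fin.sum_univ_four] using w3)
    (by simp [Fin.forall_fin_succ, firstExpo, secondExpo, le_iff_apply]; omega)
  simpa [degree_expo] using this

lemma IsCase2a.a12_add_a34_le (h : a.IsCase2a K n) (hCM : HasCohenMacaulayTangentCone K n)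
    (hpos : 0 < n 0) (hmono : StrictMono n) : a.a12 + a.a34 ≤ a.a41 + a.a23 := by
  obtain ⟨-, -, -, -, w5⟩ := h.weights
  obtain ⟨h12, h13, h23, h24, h31, h34, h41, h42, -⟩ := id h
  have := h.degree_le hCM hpos hmono (p := expo 0 a.a12 0 a.a34) (s := expo 0 0 a.a23 0)
    (k := a.a41)
    (by rw [wt_add, wt_expo, wt_expo]; simpa [wt, Fin.sum_univ_four] using w5.symm)
    (by simp [Fin.forall_fin_succ, firstExpo, secondExpo, le_iff_apply]; omega)
  simpa [degree_expo] using this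

/-- The bounds on `c₂` and `c₃` say that `x₃ ^ c₂ x₄ ^ c₃` is divisible by no term of `f₁, …, f₅`,
so it is alone in its fibre. Leaving the tail abstract serves both forms of `f₆`. -/
lemma IsCase2a.a2_add_a12_le (h : a.IsCase2a K n) (hCM : HasCohenMacaulayTangentCone K n)
    (hpos : 0 < n 0) (hmono : StrictMono n) {c₀ c₂ c₃ : ℕ}
    (hw : (a.a2 + a.a12) * n 1 = c₀ * n 0 + c₂ * n 2 + c₃ * n 3)
    (hs : c₂ < a.a3 ∧ c₃ < a.a4 ∧ (c₂ < a.a23 ∨ c₃ < a.a24)) : a.a2 + a.a12 ≤ c₀ + c₂ + c₃ := by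
  obtain ⟨h12, h13, h23, h24, h31, h34, h41, h42, -⟩ := id h
  have := h.degree_le hCM hpos hmono (p := expo 0 (a.a2 + a.a12) 0 0) (s := expo 0 0 c₂ c₃)
    (k := c₀)
    (by rw [wt_add, wt_expo, wt_expo]; simpa [wt, Fin.sum_univ_four, add_assoc] using hw)
    (by simp [Fin.forall_fin_succ, firstExpo, secondExpo, le_iff_apply]; omega)
  simpa [degree_expo, add_assoc] using this

/-- The two terms of each of `f₁, …, f₆` have the same weight. -/
lemma IsCase2a.wt_leadExpo (h : a.IsCase2a K n) {c₀ c₂ c₃ : ℕ}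
    (hw : (a.a2 + a.a12) * n 1 = c₀ * n 0 + c₂ * n 2 + c₃ * n 3) (i : Fin 6) :
    wt n (a.leadExpo i) = wt n (a.tailExpo c₀ c₂ c₃ i) := by
  obtain ⟨w1, w2, w3, w4, w5⟩ := h.weights
  fin_cases i <;> simp [leadExpo, tailExpo, wt_expo] <;> linarith

/-- In `f₁` and `f₂` the pure power is in a variable lighter than those of the other term, in `f₄`
in a heavier one; equal weights then fix the strict order of degrees. -/
lemma IsCase2a.degree_lt (h : a.IsCase2a K n) (hmono : StrictMono n) :
    a.a12 + a.a13 < a.a1 ∧ a.a23 + a.a24 < a.a2 ∧ a.a4 < a.a41 + a.a42 := by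
  obtain ⟨w1, w2, w3, w4, w5⟩ := h.weights
  obtain ⟨h12, h13, h23, h24, h31, h34, h41, h42, -⟩ := id h
  have m1 : n 0 < n 1 := hmono (by decide)
  have m2 : n 1 < n 2 := hmono (by decide)
  have m3 : n 2 < n 3 := hmono (by decide)
  refine ⟨?_, ?_, ?_⟩
  · by_contra! hle
    have e1 := Nat.mul_le_mul_right (n 0) hle
    have e2 := Nat.mul_lt_mul_of_pos_left m1 h12.1
    have e3 := Nat.mul_lt_mul_of_pos_left (m1.trans m2) h13.1
    rw [add_mul] at e1
    omega
  · by_contra! hle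
    have e1 := Nat.mul_le_mul_right (n 1) hle
    have e2 := Nat.mul_lt_mul_of_pos_left m2 h23.1
    have e3 := Nat.mul_lt_mul_of_pos_left (m2.trans m3) h24.1
    rw [add_mul] at e1
    omega
  · by_contra! hle
    have e1 := Nat.mul_le_mul_right (n 3) hle
    have e2 := Nat.mul_lt_mul_of_pos_left (m1.trans (m2.trans m3)) h41.1
    have e3 := Nat.mul_lt_mul_of_pos_left (m2.trans m3) h42.1
    rw [add_mul] at e1
    omega

/-- Where degrees can tie, the tail contains `x₁` (for `f₆` by `0 < c₀`) and the leading term does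
not, which decides the comparison at the first variable. -/
lemma IsCase2a.negDegRevLexGT (h : a.IsCase2a K n) (hmono : StrictMono n)
    {c₀ c₂ c₃ : ℕ} (hc : 0 < c₀) (i3 : a.a3 ≤ a.a31 + a.a34)
    (i5 : a.a12 + a.a34 ≤ a.a41 + a.a23) (i6 : a.a2 + a.a12 ≤ c₀ + c₂ + c₃) (i : Fin 6) :
    NegDegRevLexGT (a.leadExpo i) (a.tailExpo c₀ c₂ c₃ i) := by
  obtain ⟨d1, d2, d4⟩ := h.degree_lt hmono
  obtain ⟨h12, h13, h23, h24, h31, h34, h41, h42, -⟩ := id h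
  refine negDegRevLexGT_of_degree_le ?_ ?_ <;> fin_cases i <;>
    simp [leadExpo, tailExpo, degree_expo] <;> omega

lemma f1_eq : a.f1 K = monomial (expo a.a1 0 0 0) 1 - monomial (expo 0 a.a12 a.a13 0) 1 := by
  simp [f1, monomial_expo]

lemma f2_eq : a.f2 K = monomial (expo 0 a.a2 0 0) 1 - monomial (expo 0 0 a.a23 a.a24) 1 := by
  simp [f2, monomial_expo]

lemma f3_eq : a.f3 K = monomial (expo 0 0 a.a3 0) 1 - monomial (expo a.a31 0 0 a.a34) 1 := by
  simp [f3, monomial_expo]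

lemma f4_eq : a.f4 K = monomial (expo 0 0 0 a.a4) 1 - monomial (expo a.a41 a.a42 0 0) 1 := by
  simp [f4, monomial_expo]

lemma f5_eq : a.f5 K = monomial (expo a.a41 0 a.a23 0) 1 - monomial (expo 0 a.a12 0 a.a34) 1 := by
  simp [f5, monomial_expo]

lemma IsCase2a.isStandardBasis (h : a.IsCase2a K n) (hpos : 0 < n 0) (hmono : StrictMono n)
    (h34 : a.a34 ≤ a.a24) {c₀ c₂ c₃ : ℕ} (hc : 0 < c₀)
    (hw : (a.a2 + a.a12) * n 1 = c₀ * n 0 + c₂ * n 2 + c₃ * n 3) (i3 : a.a3 ≤ a.a31 + a.a34)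
    (i5 : a.a12 + a.a34 ≤ a.a41 + a.a23) (i6 : a.a2 + a.a12 ≤ c₀ + c₂ + c₃) :
    IsStandardBasis (toricIdeal K n) {a.f1 K, a.f2 K, a.f3 K, a.f4 K, a.f5 K,
      X 1 ^ (a.a2 + a.a12) - X 0 ^ c₀ * X 2 ^ c₂ * X 3 ^ c₃} := by
  have hn : ∀ i, 0 < n i := fun i => hpos.trans_le (hmono.monotone (Fin.zero_le i))
  have h6 : (X 1 ^ (a.a2 + a.a12) - X 0 ^ c₀ * X 2 ^ c₂ * X 3 ^ c₃ : MvPolynomial (Fin 4) K) =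
      monomial (expo 0 (a.a2 + a.a12) 0 0) 1 - monomial (expo c₀ 0 c₂ c₃) 1 := by
    simp [monomial_expo]
  have hwt := h.wt_leadExpo hw
  have hlt := h.negDegRevLexGT hmono hc i3 i5 i6
  refine isStandardBasis_of_isStandard_unique hn hwt hlt
    (h.eq_of_isStandard hn h34) (by simp) ?_ ?_
  · rw [h6, f1_eq, f2_eq, f3_eq, f4_eq, f5_eq]
    simp only [Set.insert_subset_iff, Set.singleton_subset_iff, SetLike.mem_coe,
      binomial_mem_toricIdeal]
    exact ⟨(hwt 0).symm, (hwt 1).symm, hwt 2, hwt 3, (hwt 4).symm, hwt 5⟩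
  · intro i
    fin_cases i
    · exact ⟨a.f1 K, by simp, isLeadingExponent_binomial (hlt 0) (Or.inr f1_eq)⟩
    · exact ⟨a.f2 K, by simp, isLeadingExponent_binomial (hlt 1) (Or.inr f2_eq)⟩
    · exact ⟨a.f3 K, by simp, isLeadingExponent_binomial (hlt 2) (Or.inl f3_eq)⟩
    · exact ⟨a.f4 K, by simp, isLeadingExponent_binomial (hlt 3) (Or.inl f4_eq)⟩
    · exact ⟨a.f5 K, by simp, isLeadingExponent_binomial (hlt 4) (Or.inr f5_eq)⟩
    · exact ⟨_, by simp, isLeadingExponent_binomial (hlt 5) (Or.inl h6)⟩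

lemma leadExpo_not_le (h : a.IsCase2a K n) {i j : Fin 6} (hij : j ≠ i) :
    ¬ a.leadExpo j ≤ a.leadExpo i := by
  obtain ⟨h12, h13, h23, h24, h31, h34, h41, h42, -⟩ := id h
  fin_cases i <;> fin_cases j <;> simp [leadExpo, le_iff_apply] at hij ⊢ <;> omega

lemma leadExpo_apply_zero (i : Fin 6) : a.leadExpo i 0 = 0 := by
  fin_cases i <;> rfl

/-- A family of monomials and binomials with the leading exponents of `f₁, …, f₆` and the other
terms divisible by `x₁` generates its span irredundantly. -/
lemma IsCase2a.notMem_span (h : a.IsCase2a K n) {g : Fin 6 → MvPolynomial (Fin 4) K}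
    {q : Fin 6 → Fin 4 →₀ ℕ}
    (hg : ∀ i, g i = monomial (a.leadExpo i) 1 ∨ (0 < q i 0 ∧
      (g i = monomial (a.leadExpo i) 1 - monomial (q i) 1 ∨
        g i = monomial (q i) 1 - monomial (a.leadExpo i) 1))) (i : Fin 6) :
    g i ∉ Ideal.span (g '' {i}ᶜ) := by
  classical
  refine notMem_span_image_compl (s := a.leadExpo i) ?_ fun j hj u hu hle => ?_
  · have hne : 0 < q i 0 → q i ≠ a.leadExpo i := fun hq he => by
      rw [he, leadExpo_apply_zero] at hq
      exact lt_irrefl _ hq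
    rcases hg i with hi | ⟨hq, hi | hi⟩
    · simp [hi]
    · simp [hi, coeff_sub, coeff_monomial, hne hq]
    · simp [hi, coeff_sub, coeff_monomial, hne hq]
  -- A term dividing a leading monomial is free of `x₁`, hence is itself the leading one; but the
  -- leading monomials form an antichain under divisibility.
  · have h0 : u 0 = 0 := by
      have := (le_iff_apply.1 hle).1
      rwa [leadExpo_apply_zero, Nat.le_zero] at this
    have hne : u ≠ a.leadExpo j := fun he => leadExpo_not_le h hj (he ▸ hle)
    have hne' : 0 < q j 0 → q j ≠ u := fun hq he => by
      rw [he, h0] at hq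
      exact lt_irrefl _ hq
    rw [mem_support_iff] at hu
    rcases hg j with hi | ⟨hq, hi | hi⟩
    · simp [hi, coeff_monomial, hne.symm] at hu
    · simp [hi, coeff_sub, coeff_monomial, hne.symm, hne' hq] at hu
    · simp [hi, coeff_sub, coeff_monomial, hne.symm, hne' hq] at hu

lemma IsCase2a.isMinimallyGeneratedBy (h : a.IsCase2a K n) (hpos : 0 < n 0) (hmono : StrictMono n)
    (h34 : a.a34 ≤ a.a24) {c₀ c₂ c₃ : ℕ} (hc : 0 < c₀)
    (hw : (a.a2 + a.a12) * n 1 = c₀ * n 0 + c₂ * n 2 + c₃ * n 3) (i3 : a.a3 ≤ a.a31 + a.a34)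
    (i5 : a.a12 + a.a34 ≤ a.a41 + a.a23) (i6 : a.a2 + a.a12 ≤ c₀ + c₂ + c₃) :
    IsMinimallyGeneratedBy (lowestFormIdeal (toricIdeal K n))
      ![X 1 ^ a.a12 * X 2 ^ a.a13,
        X 2 ^ a.a23 * X 3 ^ a.a24,
        if a.a3 < a.a31 + a.a34 then X 2 ^ a.a3
          else X 2 ^ a.a3 - X 0 ^ a.a31 * X 3 ^ a.a34,
        X 3 ^ a.a4,
        if a.a12 + a.a34 < a.a41 + a.a23 then X 1 ^ a.a12 * X 3 ^ a.a34
          else X 0 ^ a.a41 * X 2 ^ a.a23 - X 1 ^ a.a12 * X 3 ^ a.a34,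
        if a.a2 + a.a12 < c₀ + c₂ + c₃ then X 1 ^ (a.a2 + a.a12)
          else X 1 ^ (a.a2 + a.a12) - X 0 ^ c₀ * X 2 ^ c₂ * X 3 ^ c₃] := by
  have hn : ∀ i, 0 < n i := fun i => hpos.trans_le (hmono.monotone (Fin.zero_le i))
  obtain ⟨d1, d2, d4⟩ := h.degree_lt hmono
  have hwt := h.wt_leadExpo hw
  have hlt := h.negDegRevLexGT hmono hc i3 i5 i6
  obtain ⟨h12, h13, h23, h24, h31, h34', h41, h42, -⟩ := id h
  set g : Fin 6 → MvPolynomial (Fin 4) K := _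
  change IsMinimallyGeneratedBy _ g
  have hg : ∀ i, ((a.leadExpo i).degree < (a.tailExpo c₀ c₂ c₃ i).degree ∧
      g i = monomial (a.leadExpo i) 1) ∨
      ((a.leadExpo i).degree = (a.tailExpo c₀ c₂ c₃ i).degree ∧ 0 < a.tailExpo c₀ c₂ c₃ i 0 ∧
      (g i = monomial (a.leadExpo i) 1 - monomial (a.tailExpo c₀ c₂ c₃ i) 1 ∨
        g i = monomial (a.tailExpo c₀ c₂ c₃ i) 1 - monomial (a.leadExpo i) 1)) := by
    intro i
    fin_cases i
    · left; simp [g, leadExpo, tailExpo, degree_expo, monomial_expo]; omega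
    · left; simp [g, leadExpo, tailExpo, degree_expo, monomial_expo]; omega
    · by_cases hlt : a.a3 < a.a31 + a.a34
      · left; simp [g, leadExpo, tailExpo, degree_expo, monomial_expo, hlt]
      · right
        refine ⟨?_, ?_, Or.inl ?_⟩
        · simp [leadExpo, tailExpo, degree_expo]; omega
        · simp [tailExpo]; omega
        · simp [g, leadExpo, tailExpo, monomial_expo, hlt]
    · left; simp [g, leadExpo, tailExpo, degree_expo, monomial_expo]; omega
    · by_cases hlt : a.a12 + a.a34 < a.a41 + a.a23
      · left; simp [g, leadExpo, tailExpo, degree_expo, monomial_expo, hlt]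
      · right
        refine ⟨?_, ?_, Or.inr ?_⟩
        · simp [leadExpo, tailExpo, degree_expo]; omega
        · simp [tailExpo]; omega
        · simp [g, leadExpo, tailExpo, monomial_expo, hlt]
    · by_cases hlt : a.a2 + a.a12 < c₀ + c₂ + c₃
      · left; simp [g, leadExpo, tailExpo, degree_expo, monomial_expo, hlt]
      · right
        refine ⟨?_, ?_, Or.inl ?_⟩
        · simp [leadExpo, tailExpo, degree_expo]; omega
        · simp [tailExpo]; omega
        · simp [g, leadExpo, tailExpo, monomial_expo, hlt]
  refine ⟨lowestFormIdeal_eq_of_isStandard_unique hn hwt hlt (h.eq_of_isStandard hn h34)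
    (Ideal.span_le.2 ?_) (fun i => ?_),
    h.notMem_span (q := a.tailExpo c₀ c₂ c₃) fun i => (hg i).imp And.right And.right⟩
  · rintro _ ⟨i, rfl⟩
    rcases hg i with ⟨hd, hi⟩ | ⟨hd, -, hi | hi⟩
    · rw [hi]; exact monomial_mem_lowestFormIdeal (hwt i) hd
    · rw [hi]; exact binomial_mem_lowestFormIdeal (hwt i) hd
    · rw [hi]; exact binomial_mem_lowestFormIdeal (hwt i).symm hd.symm
  · have hmem : g i ∈ Ideal.span (Set.range g) := Ideal.subset_span ⟨i, rfl⟩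
    rcases hg i with ⟨-, hi⟩ | ⟨-, -, hi | hi⟩
    · exact Or.inl (hi ▸ hmem)
    · exact Or.inr (hi ▸ hmem)
    · refine Or.inr ?_
      rw [← neg_sub, ← hi]
      exact Submodule.neg_mem _ hmem

end ExponentData

end

theorem theorem2p15 (K : Type*) [Field K] (n : Fin 4 → ℕ) (a : ExponentData)
    (hn_pos : 0 < n 0) (hn_mono : StrictMono n) (hn_gcd : Finset.univ.gcd n = 1)
    (hcase : a.IsCase2a K n) (hCM : HasCohenMacaulayTangentCone K n)
    (h34 : a.a34 ≤ a.a24) :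
    (a.a23 < a.a13 →
      IsStandardBasis (toricIdeal K n)
        {a.f1 K, a.f2 K, a.f3 K, a.f4 K, a.f5 K, a.f6 K} ∧
      -- the eight cases of equality or strict inequality in the three bounds
      (a.a3 ≤ a.a31 + a.a34 →
        a.a2 + a.a12 ≤ a.a41 + 2 * a.a23 + (a.a24 - a.a34) →
        a.a12 + a.a34 ≤ a.a41 + a.a23 →
        IsMinimallyGeneratedBy (lowestFormIdeal (toricIdeal K n))
          ![X 1 ^ a.a12 * X 2 ^ a.a13,
            X 2 ^ a.a23 * X 3 ^ a.a24,
            if a.a3 < a.a31 + a.a34 then X 2 ^ a.a3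
              else X 2 ^ a.a3 - X 0 ^ a.a31 * X 3 ^ a.a34,
            X 3 ^ a.a4,
            if a.a12 + a.a34 < a.a41 + a.a23 then X 1 ^ a.a12 * X 3 ^ a.a34
              else X 0 ^ a.a41 * X 2 ^ a.a23 - X 1 ^ a.a12 * X 3 ^ a.a34,
            if a.a2 + a.a12 < a.a41 + 2 * a.a23 + (a.a24 - a.a34) then X 1 ^ (a.a2 + a.a12)
              else X 1 ^ (a.a2 + a.a12) -
                X 0 ^ a.a41 * X 2 ^ (2 * a.a23) * X 3 ^ (a.a24 - a.a34)])) ∧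
    (a.a13 ≤ a.a23 →
      IsStandardBasis (toricIdeal K n)
        {a.f1 K, a.f2 K, a.f3 K, a.f4 K, a.f5 K, a.f6' K} ∧
      (a.a3 ≤ a.a31 + a.a34 →
        a.a2 + a.a12 ≤ a.a1 + a.a24 + (a.a23 - a.a13) →
        a.a12 + a.a34 ≤ a.a41 + a.a23 →
        IsMinimallyGeneratedBy (lowestFormIdeal (toricIdeal K n))
          ![X 1 ^ a.a12 * X 2 ^ a.a13,
            X 2 ^ a.a23 * X 3 ^ a.a24,
            if a.a3 < a.a31 + a.a34 then X 2 ^ a.a3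
              else X 2 ^ a.a3 - X 0 ^ a.a31 * X 3 ^ a.a34,
            X 3 ^ a.a4,
            if a.a12 + a.a34 < a.a41 + a.a23 then X 1 ^ a.a12 * X 3 ^ a.a34
              else X 0 ^ a.a41 * X 2 ^ a.a23 - X 1 ^ a.a12 * X 3 ^ a.a34,
            if a.a2 + a.a12 < a.a1 + a.a24 + (a.a23 - a.a13) then X 1 ^ (a.a2 + a.a12)
              else X 1 ^ (a.a2 + a.a12) -
                X 0 ^ a.a1 * X 2 ^ (a.a23 - a.a13) * X 3 ^ a.a24])) := by
  have hw := hcase.weights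
  have hn : ∀ i, 0 < n i := fun i => hn_pos.trans_le (hn_mono.monotone (Fin.zero_le i))
  obtain ⟨r1, r2, r3, r4⟩ := hcase.relations hn
  obtain ⟨h12, h13, h23, h24, h31, h34', h41, h42, -⟩ := id hcase
  obtain ⟨w1, w2, w3, w4, w5⟩ := hw
  have i3 := hcase.a3_le hCM hn_pos hn_mono
  have i5 := hcase.a12_add_a34_le hCM hn_pos hn_mono
  refine ⟨fun hlt => ?_, fun hle => ?_⟩
  -- The weights of `f₂` and `f₅` combined; `a₃₄ ≤ a₂₄` keeps the subtraction honest.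
  · have hw6 : (a.a2 + a.a12) * n 1 =
        a.a41 * n 0 + 2 * a.a23 * n 2 + (a.a24 - a.a34) * n 3 := by
      obtain ⟨d, hd⟩ := Nat.exists_eq_add_of_le h34
      rw [hd] at w2 ⊢
      rw [Nat.add_sub_cancel_left]
      linarith
    -- Here `2 a₂₃ < a₁₃ + a₂₃ = a₃`, and `a₂₄ - a₃₄ < a₂₄` because `a₃₄ > 0`.
    have i6 := hcase.a2_add_a12_le hCM hn_pos hn_mono hw6 (by omega)
    exact ⟨hcase.isStandardBasis hn_pos hn_mono h34 h41.1 hw6 i3 i5 i6, fun _ _ _ =>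
      hcase.isMinimallyGeneratedBy hn_pos hn_mono h34 h41.1 hw6 i3 i5 i6⟩
  -- Now `f₂` is combined with `f₁`, which needs `a₁₃ ≤ a₂₃`.
  · have hw6 : (a.a2 + a.a12) * n 1 =
        a.a1 * n 0 + (a.a23 - a.a13) * n 2 + a.a24 * n 3 := by
      obtain ⟨d, hd⟩ := Nat.exists_eq_add_of_le hle
      rw [hd] at w2 ⊢
      rw [Nat.add_sub_cancel_left]
      linarith
    have i6 := hcase.a2_add_a12_le hCM hn_pos hn_mono hw6 (by omega)
    have h1 : 0 < a.a1 := by omega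
    rw [add_right_comm]
    exact ⟨hcase.isStandardBasis hn_pos hn_mono h34 h1 hw6 i3 i5 i6, fun _ _ _ =>
      hcase.isMinimallyGeneratedBy hn_pos hn_mono h34 h1 hw6 i3 i5 i6⟩
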